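/- **Setting.** Let $\mathcal B$ be a small category, $\mathcal G = \mathrm{Set}^{\mathcal B}$ the category of (covariant) functors $\mathcal B\to\mathrm{Set}$, and let $I$ be a finite directed multigraph (finitely many vertices $I_0$ and edges $I_1$) without directed cycles. A diagram $\mathcal D: I\to\mathcal G$ assigns to each vertex $i$ an object $\mathcal D_i$ and to each edge $d:i\to j$ a morphism $\mathcal D_d:\mathcal D_i\to\mathcal D_j$; a natural transformation $\tau:\mathcal E\Rightarrow\mathcal D$ of diagrams is a family $(\tau_i:\mathcal E_i\to\mathcal D_i)_i$ with $\tau_j\circ\mathcal E_d=\mathcal D_d\circ\tau_i$ for every edge $d:i\to j$, and it is *cartesian* if all these squares are pullbacks. $\Delta S$ is the constant diagram at $S$. A cocone $\kappa:\mathcal D\Rightarrow\Delta S$ is *colimiting* if every $\rho:\mathcal D\Rightarrow\Delta T$ equals $\Delta u\circ\kappa$ for a unique $u:S\to T$. It has the *Van Kampen property* if the functor $\kappa^*$ from the slice category $\mathcal G/S$ to the category of cartesian natural transformations into $\mathcal D$ (a full subcategory of the slice category of diagrams over $\mathcal D$), which pulls back morphisms $K\to S$ along the components $\kappa_i$, is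 an equivalence of categories. **Indices.** A vertex of $I$ is *minimal* if it has no outgoing edge and *branching* if it has at least two outgoing edges. A *branch* is a directed path in $I$ from a branching vertex to a minimal vertex. A minimal vertex is *affected* if it is the target of at least one branch; $Af(I)$ is the set of affected minimal vertices. For a directed path $p$ let $\mathcal D_p$ be the composite of the $\mathcal D_d$ along $p$. $\mathcal D$ is *image-disjoint* if $\mathcal D_p(y)\neq\mathcal D_{p'}(y)$, as elements of the disjoint union $\coprod_{k\in I_0}\mathcal D_k(X)$, for all different branches $p,p'$ with the same source $i$, all $X\in\mathcal B$ and all $y\in\mathcal D_i(X)$. **Paths.** Fix $X\in\mathcal B$. A *path segment* of sort $X$ is a triple $(y,d,y')$ or $(y',d^{op},y)$ with $d:i\to j$ an edge, $y\in\mathcal D_i(X)$ and $y'=\mathcal D_d(y)\in\mathcal D_j(X)$; two segments are *weakly equal* if they are equal or one is the reverse of the other (the reverse of $(y,\delta,y')$ is $(y',\delta^{op},y)$, with $(d^{op})^{op}=d$). A *mapping path* of sort $X$ from $z$ to $z'$ is a finite sequence of segments $(y_0,\delta_0,y_1),(y_1,\delta_1,y_2),\dots,(y_{n-1},\delta_{n-1},y_n)$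 with $y_0=z$, $y_n=z'$; the empty sequence is a path from each element to itself. Elements are taken in $\coprod_{i}\mathcal D_i(X)$, so that elements of different components are different. Paths are equal if they are equal as sequences. A path is *proper* if no two of its segments at different positions are weakly equal, and *inner-cycle free* if $y_i\neq y_j$ whenever $0\le i<j\le n$ and $j-i\le n-1$. **Theorem (Different paths connecting affected minimal components).** Let $\mathcal D:I\to\mathcal G$ be an image-disjoint diagram and $\kappa:\mathcal D\Rightarrow\Delta S$ a colimiting cocone. The following are equivalent: 1. $\kappa$ has the Van Kampen property. 2. For all $X\in\mathcal B$, all $i,j\in Af(I)$, all $z\in\mathcal D_i(X)$ and $z'\in\mathcal D_j(X)$, there are no two different proper mapping paths from $z$ to $z'$. 3. For all $X\in\mathcal B$, all $i,j\in Af(I)$, all $z\in\mathcal D_i(X)$ and $z'\in\mathcal D_j(X)$, there are no two different inner-cycle free proper mapping paths from $z$ to $z'$. -/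

import Mathlib

open CategoryTheory CategoryTheory.Limits

universe v₁ u₁ v u w

attribute [-instance] CategoryTheory.catToReflQuiver

namespace GraphVK

/-! ### Diagrams over a schema multigraph -/

/-- A diagram `D : I → C` on a directed multigraph `I`: a graph morphism from `I` to the underlying
graph of the category `C`. -/
structure Diagram (I : Type u₁) [Quiver.{v₁} I] (C : Type u) [Category.{v} C] where
  obj : I → C
  map : ∀ {i j : I}, (i ⟶ j) → (obj i ⟶ obj j)

namespace Diagram

variable {I : Type u₁} [Quiver.{v₁} I] {C : Type u} [Category.{v} C]

/-- A natural transformation between diagrams: a family of morphisms commuting with the morphisms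
given by the edges of `I`. -/
@[ext]
structure Hom (E D : Diagram I C) where
  app : ∀ i : I, E.obj i ⟶ D.obj i
  naturality : ∀ {i j : I} (d : i ⟶ j), E.map d ≫ app j = app i ≫ D.map d

/-- The category of diagrams and natural transformations. -/
instance : Category (Diagram I C) where
  Hom E D := Hom E D
  id D := { app := fun i => 𝟙 (D.obj i), naturality := fun d => by simp }
  comp f g :=
    { app := fun i => f.app i ≫ g.app i
      naturality := fun d => by
        rw [← Category.assoc, f.naturality, Category.assoc, g.naturality, Category.assoc] }
  id_comp f := Hom.ext (funext fun i => Category.id_comp (f.app i))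
  comp_id f := Hom.ext (funext fun i => Category.comp_id (f.app i))
  assoc f g h := Hom.ext (funext fun i => Category.assoc (f.app i) (g.app i) (h.app i))

@[simp] theorem id_app (D : Diagram I C) (i : I) : Hom.app (𝟙 D) i = 𝟙 (D.obj i) := rfl

@[simp] theorem comp_app {D E F : Diagram I C} (f : D ⟶ E) (g : E ⟶ F) (i : I) :
    Hom.app (f ≫ g) i = Hom.app f i ≫ Hom.app g i := rfl

theorem hom_ext {D E : Diagram I C} {f g : D ⟶ E} (h : ∀ i, Hom.app f i = Hom.app g i) : f = g :=
  Hom.ext (funext h)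

/-- The functor sending an object `S` to the constant diagram `ΔS`. -/
def const (I : Type u₁) [Quiver.{v₁} I] (C : Type u) [Category.{v} C] : C ⥤ Diagram I C where
  obj S := { obj := fun _ => S, map := fun _ => 𝟙 S }
  map f := { app := fun _ => f, naturality := fun _ => by simp }

/-- A natural transformation is cartesian if all its naturality squares are pullbacks. -/
def IsCartesian {E D : Diagram I C} (τ : E ⟶ D) : Prop :=
  ∀ {i j : I} (d : i ⟶ j), IsPullback (E.map d) (Hom.app τ i) (Hom.app τ j) (D.map d)

/-- The full subcategory of the category of diagrams over `D` whose objects are the cartesian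
natural transformations into `D`. -/
abbrev CartesianOver (D : Diagram I C) :=
  ObjectProperty.FullSubcategory (fun τ : Over D => IsCartesian τ.hom)

/-- The component `κ_i : D_i → S` of a commutative cocone `κ : D ⇒ ΔS`. -/
def leg {D : Diagram I C} {S : C} (κ : D ⟶ (const I C).obj S) (i : I) : D.obj i ⟶ S :=
  Hom.app κ i

theorem leg_w {D : Diagram I C} {S : C} (κ : D ⟶ (const I C).obj S) {i j : I} (d : i ⟶ j) :
    D.map d ≫ leg κ j = leg κ i :=
  (Hom.naturality κ d).trans (Category.comp_id _)

/-- A commutative cocone `κ : D ⇒ ΔS` is colimiting if every commutative cocone factors uniquely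
through it. -/
def IsColimiting {D : Diagram I C} {S : C} (κ : D ⟶ (const I C).obj S) : Prop :=
  ∀ (T : C) (ρ : D ⟶ (const I C).obj T), ∃! t : S ⟶ T, κ ≫ (const I C).map t = ρ

section Pullback

variable [HasPullbacks C] {D : Diagram I C} {S : C} (κ : D ⟶ (const I C).obj S)

/-- The morphism between the (chosen) pullbacks of `σ : K → S` along `κ_i` and `κ_j` induced by an
edge `d : i → j`. -/
noncomputable def pullbackEdge (σ : Over S) {i j : I} (d : i ⟶ j) :
    pullback (leg κ i) σ.hom ⟶ pullback (leg κ j) σ.hom :=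
  pullback.lift (pullback.fst (leg κ i) σ.hom ≫ D.map d) (pullback.snd (leg κ i) σ.hom)
    (by rw [Category.assoc, leg_w, pullback.condition])

@[simp] theorem pullbackEdge_fst (σ : Over S) {i j : I} (d : i ⟶ j) :
    pullbackEdge κ σ d ≫ pullback.fst (leg κ j) σ.hom = pullback.fst (leg κ i) σ.hom ≫ D.map d :=
  pullback.lift_fst _ _ _

@[simp] theorem pullbackEdge_snd (σ : Over S) {i j : I} (d : i ⟶ j) :
    pullbackEdge κ σ d ≫ pullback.snd (leg κ j) σ.hom = pullback.snd (leg κ i) σ.hom :=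
  pullback.lift_snd _ _ _

/-- The morphism between the (chosen) pullbacks of `σ` and `σ'` along `κ_i` induced by a morphism
over `S`. -/
noncomputable def pullbackComp {σ σ' : Over S} (γ : σ ⟶ σ') (i : I) :
    pullback (leg κ i) σ.hom ⟶ pullback (leg κ i) σ'.hom :=
  pullback.lift (pullback.fst (leg κ i) σ.hom) (pullback.snd (leg κ i) σ.hom ≫ γ.left)
    (by rw [Category.assoc, Over.w, pullback.condition])

@[simp] theorem pullbackComp_fst {σ σ' : Over S} (γ : σ ⟶ σ') (i : I) :
    pullbackComp κ γ i ≫ pullback.fst (leg κ i) σ'.hom = pullback.fst (leg κ i) σ.hom :=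
  pullback.lift_fst _ _ _

@[simp] theorem pullbackComp_snd {σ σ' : Over S} (γ : σ ⟶ σ') (i : I) :
    pullbackComp κ γ i ≫ pullback.snd (leg κ i) σ'.hom =
      pullback.snd (leg κ i) σ.hom ≫ γ.left :=
  pullback.lift_snd _ _ _

theorem pullbackComp_id (σ : Over S) (i : I) : pullbackComp κ (𝟙 σ) i = 𝟙 _ := by
  apply pullback.hom_ext <;> simp

theorem pullbackComp_comp {σ σ' σ'' : Over S} (γ : σ ⟶ σ') (γ' : σ' ⟶ σ'') (i : I) :
    pullbackComp κ (γ ≫ γ') i = pullbackComp κ γ i ≫ pullbackComp κ γ' i := by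
  apply pullback.hom_ext
  · rw [Category.assoc, pullbackComp_fst, pullbackComp_fst, pullbackComp_fst]
  · rw [Category.assoc, pullbackComp_snd, pullbackComp_snd, ← Category.assoc, pullbackComp_snd,
      Category.assoc, Over.comp_left]

theorem pullbackComp_naturality {σ σ' : Over S} (γ : σ ⟶ σ') {i j : I} (d : i ⟶ j) :
    pullbackEdge κ σ d ≫ pullbackComp κ γ j = pullbackComp κ γ i ≫ pullbackEdge κ σ' d := by
  apply pullback.hom_ext
  · rw [Category.assoc, Category.assoc, pullbackComp_fst, pullbackEdge_fst, pullbackEdge_fst,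
      ← Category.assoc, pullbackComp_fst]
  · rw [Category.assoc, Category.assoc, pullbackComp_snd, pullbackEdge_snd, pullbackComp_snd,
      ← Category.assoc, pullbackEdge_snd]

theorem pullbackEdge_isPullback (σ : Over S) {i j : I} (d : i ⟶ j) :
    IsPullback (pullbackEdge κ σ d) (pullback.fst (leg κ i) σ.hom)
      (pullback.fst (leg κ j) σ.hom) (D.map d) := by
  refine IsPullback.of_right (h₁₂ := pullback.snd (leg κ j) σ.hom)
    (h₂₂ := leg κ j) (v₁₃ := σ.hom) ?_ (pullbackEdge_fst κ σ d)
    (IsPullback.of_hasPullback (leg κ j) σ.hom).flip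
  rw [pullbackEdge_snd, leg_w]
  exact (IsPullback.of_hasPullback (leg κ i) σ.hom).flip

/-- The diagram of the pullbacks of `σ : K → S` along the components of a cocone. -/
noncomputable def pullbackDiagram (σ : Over S) : Diagram I C where
  obj i := pullback (leg κ i) σ.hom
  map d := pullbackEdge κ σ d

/-- The projections of the pullbacks, as a natural transformation into `D`. -/
noncomputable def pullbackHom (σ : Over S) : pullbackDiagram κ σ ⟶ D where
  app i := pullback.fst (leg κ i) σ.hom
  naturality d := pullbackEdge_fst κ σ d

/-- The natural transformation induced on pullbacks by a morphism over `S`. -/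
noncomputable def pullbackMap {σ σ' : Over S} (γ : σ ⟶ σ') :
    pullbackDiagram κ σ ⟶ pullbackDiagram κ σ' where
  app i := pullbackComp κ γ i
  naturality d := pullbackComp_naturality κ γ d

/-- The functor `κ^*`, pulling back morphisms into `S` along the components of a cocone
`κ : D ⇒ ΔS`. -/
noncomputable def pullbackFunctor : Over S ⥤ CartesianOver D where
  obj σ := ⟨Over.mk (pullbackHom κ σ), fun d => pullbackEdge_isPullback κ σ d⟩
  map γ := ObjectProperty.homMk (Over.homMk (pullbackMap κ γ)
    (hom_ext fun i => pullbackComp_fst κ γ i))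
  map_id σ := ObjectProperty.hom_ext _ (Over.OverMorphism.ext
    (hom_ext fun i => pullbackComp_id κ σ i))
  map_comp γ γ' := ObjectProperty.hom_ext _ (Over.OverMorphism.ext
    (hom_ext fun i => pullbackComp_comp κ γ γ' i))

/-- A cocone `κ : D ⇒ ΔS` has the Van Kampen property if `κ^*` is an equivalence of
categories. -/
def IsVanKampen : Prop := (pullbackFunctor κ).IsEquivalence

end Pullback

end Diagram

/-! ### Mapping paths -/

section MappingPath

variable {I : Type u₁} [Quiver.{v₁} I] {B : Type u} [Category.{v} B]

/-- The elements of sort `X`: the disjoint union of the sets `D_i(X)`. -/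
abbrev Elem (D : Diagram I (B ⥤ Type w)) (X : B) := Σ i : I, (D.obj i).obj X

/-- The map on elements of sort `X` induced by an edge. -/
def edgeMap (D : Diagram I (B ⥤ Type w)) (X : B) {i j : I} (d : i ⟶ j)
    (y : (D.obj i).obj X) : (D.obj j).obj X :=
  (D.map d).app X y

/-- Edges `d` of `I` (`inl`) together with formal opposites `d^op` (`inr`). -/
abbrev SignedEdge (I : Type u₁) [Quiver.{v₁} I] := Quiver.Total I ⊕ Quiver.Total I

/-- The path segments `(y, δ, y')` of sort `X`. -/
@[ext]
structure PathSegment (D : Diagram I (B ⥤ Type w)) (X : B) where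
  fst : Elem D X
  edge : SignedEdge I
  snd : Elem D X
  valid : match edge with
    | .inl d => ∃ y : (D.obj d.left).obj X,
        fst = ⟨d.left, y⟩ ∧ snd = ⟨d.right, edgeMap D X d.hom y⟩
    | .inr d => ∃ y' : (D.obj d.left).obj X,
        snd = ⟨d.left, y'⟩ ∧ fst = ⟨d.right, edgeMap D X d.hom y'⟩

variable {D : Diagram I (B ⥤ Type w)} {X : B}

/-- Segments `(y₁, δ₁, y₁')`, `(y₂, δ₂, y₂')` are weakly equal if they are equal or
`(y₁, δ₁, y₁') = (y₂', δ₂^op, y₂)`. -/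
def WeaklyEqual (s t : PathSegment D X) : Prop :=
  s = t ∨ (s.fst = t.snd ∧ s.edge = t.edge.swap ∧ s.snd = t.fst)

/-- `Connects P z z'`: the list `P` of path segments is a mapping path from `z` to `z'`. The empty
path connects every element with itself. -/
def Connects : List (PathSegment D X) → Elem D X → Elem D X → Prop
  | [], z, z' => z = z'
  | s :: P, z, z' => s.fst = z ∧ Connects P s.snd z'

/-- A mapping path is proper if no two segments (at different positions) are weakly equal. -/
def IsProper (P : List (PathSegment D X)) : Prop :=
  P.Pairwise fun s t => ¬ WeaklyEqual s t

/-- The elements `y_0, …, y_n` visited by a mapping path of length `n ≥ 1`. -/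
def visited : List (PathSegment D X) → List (Elem D X)
  | [] => []
  | s :: P => s.fst :: (s :: P).map PathSegment.snd

/-- A mapping path of length `n` is inner-cycle free if `y_i ≠ y_j` for all `0 ≤ i < j ≤ n` with
`j - i ≤ n - 1`. -/
def IsInnerCycleFree (P : List (PathSegment D X)) : Prop :=
  ∀ i j : ℕ, i < j → j ≤ P.length → j - i < P.length → (visited P)[i]? ≠ (visited P)[j]?

end MappingPath

/-! ### Minimal, branching and affected indices -/

section Indices

variable {I : Type u₁} [Quiver.{v₁} I]

/-- A multigraph has no directed cycles: every closed directed path is the empty one. -/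
def NoDirectedCycles (I : Type u₁) [Quiver.{v₁} I] : Prop :=
  ∀ (i : I) (p : Quiver.Path i i), p = Quiver.Path.nil

/-- Minimal indices: vertices without outgoing edges. -/
def IsMinimal (i : I) : Prop := ∀ j : I, IsEmpty (i ⟶ j)

/-- Branching indices: vertices with at least two outgoing edges. -/
def IsBranching (i : I) : Prop := ∃ e e' : (Σ j : I, i ⟶ j), e ≠ e'

/-- Affected minimal indices: minimal indices that are the target of at least one branch, i.e. of a
directed path from a branching index to a minimal index. -/
def IsAffected (j : I) : Prop :=
  IsMinimal j ∧ ∃ i : I, IsBranching i ∧ Nonempty (Quiver.Path i j)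

/-- The map `D_p` on elements of sort `X`, for a directed path `p` in `I`. -/
def pathMap {B : Type u} [Category.{v} B] (D : Diagram I (B ⥤ Type w)) (X : B) {i : I} :
    ∀ {j : I}, Quiver.Path i j → (D.obj i).obj X → (D.obj j).obj X
  | _, .nil, y => y
  | _, .cons p d, y => edgeMap D X d (pathMap D X p y)

/-- A diagram is image disjoint if different branches with a common source never send an element to
the same element. -/
def ImageDisjoint {B : Type u} [Category.{v} B] (D : Diagram I (B ⥤ Type w)) : Prop :=
  ∀ (i j j' : I) (p : Quiver.Path i j) (p' : Quiver.Path i j'),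
    IsBranching i → IsMinimal j → IsMinimal j' →
    (⟨j, p⟩ : Σ k : I, Quiver.Path i k) ≠ ⟨j', p'⟩ →
    ∀ (X : B) (y : (D.obj i).obj X),
      (⟨j, pathMap D X p y⟩ : Elem D X) ≠ ⟨j', pathMap D X p' y⟩

end Indices

end GraphVK

/-!
In a presheaf category colimits are universal, so for a colimiting `κ` the functor `κ^*` is always
fully faithful, and the Van Kampen property says that every cartesian transformation `τ : E ⟶ D`
descends to the colimit. The obstruction is monodromy: in the graph of elements of `D`, whose
components of sort `X` are the elements of `S(X)`, a cartesian `τ` is a covering, and it descends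
iff walks of `E` over closed walks of `D` are closed. The double coverings already detect every
closed proper path, so the Van Kampen property forces proper paths to be unique. Conversely
monodromy is trivial if there is no simple closed path. Since `I` has no directed cycles, a simple
closed path leaves some elements along two different edges; by image-disjointness the descents from
there to minimal vertices do not meet again, and together with the two arcs of the closed path they
yield two different simple paths between the same affected elements.
-/

namespace GraphVK

open Diagram

/-! ### Concatenation, reversal and simple paths -/

section PathCalculus

variable {I : Type u₁} [Quiver.{v₁} I] {B : Type u} [Category.{v} B]
  {D : Diagram I (B ⥤ Type w)} {X : B}

namespace PathSegment

/-- The segment `(y, d, D_d(y))`. -/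
def forward {i j : I} (d : i ⟶ j) (y : (D.obj i).obj X) : PathSegment D X :=
  ⟨⟨i, y⟩, .inl ⟨i, j, d⟩, ⟨j, edgeMap D X d y⟩, y, rfl, rfl⟩

/-- The segment `(D_d(y), d^op, y)`. -/
def backward {i j : I} (d : i ⟶ j) (y : (D.obj i).obj X) : PathSegment D X :=
  ⟨⟨j, edgeMap D X d y⟩, .inr ⟨i, j, d⟩, ⟨i, y⟩, y, rfl, rfl⟩

@[elab_as_elim]
theorem forward_backward_cases {motive : PathSegment D X → Prop}
    (forward : ∀ {i j : I} (d : i ⟶ j) (y : (D.obj i).obj X), motive (forward d y))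
    (backward : ∀ {i j : I} (d : i ⟶ j) (y : (D.obj i).obj X), motive (backward d y))
    (s : PathSegment D X) : motive s := by
  obtain ⟨a, d | d, b, y, h₁, h₂⟩ := s
  · subst h₁ h₂
    exact forward d.hom y
  · subst h₁ h₂
    exact backward d.hom y

/-- The reverse of a path segment. -/
def rev (s : PathSegment D X) : PathSegment D X where
  fst := s.snd
  edge := s.edge.swap
  snd := s.fst
  valid := by
    cases s using forward_backward_cases with
    | forward d y => exact ⟨y, rfl, rfl⟩
    | backward d y => exact ⟨y, rfl, rfl⟩

/-- The class of a path segment up to weak equality: the underlying edge of `I` together with the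
element of its source. -/
def key (s : PathSegment D X) : Quiver.Total I × Elem D X :=
  match s.edge with
  | .inl d => (d, s.fst)
  | .inr d => (d, s.snd)

theorem key_rev (s : PathSegment D X) : s.rev.key = s.key := by
  cases s using forward_backward_cases <;> rfl

end PathSegment

open PathSegment

theorem weaklyEqual_iff_key_eq {s t : PathSegment D X} : WeaklyEqual s t ↔ s.key = t.key := by
  constructor
  · rintro (rfl | ⟨h₁, h₂, h₃⟩)
    · rfl
    · rw [show s = t.rev from PathSegment.ext h₁ h₂ h₃, key_rev]
  · intro h
    obtain ⟨hd, hy⟩ := Prod.ext_iff.1 h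
    cases s using forward_backward_cases <;> cases t using forward_backward_cases <;>
      simp only [key, forward, backward] at hd hy <;> cases hd <;> cases hy
    · exact .inl rfl
    · exact .inr ⟨rfl, rfl, rfl⟩
    · exact .inr ⟨rfl, rfl, rfl⟩
    · exact .inl rfl

theorem isProper_iff_nodup {P : List (PathSegment D X)} :
    IsProper P ↔ (P.map key).Nodup := by
  simp only [IsProper, List.Nodup, List.pairwise_map, weaklyEqual_iff_key_eq, ne_eq]

variable {P Q : List (PathSegment D X)} {z m z' : Elem D X}

theorem connects_append :
    Connects (P ++ Q) z z' ↔ ∃ m, Connects P z m ∧ Connects Q m z' := by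
  induction P generalizing z with
  | nil => simp [Connects]
  | cons s P ih => simp [Connects, ih, and_assoc]

theorem Connects.append (hP : Connects P z m) (hQ : Connects Q m z') :
    Connects (P ++ Q) z z' :=
  connects_append.2 ⟨m, hP, hQ⟩

theorem connects_singleton (s : PathSegment D X) : Connects [s] s.fst s.snd := ⟨rfl, rfl⟩

/-- The reverse of a mapping path. -/
def revPath (P : List (PathSegment D X)) : List (PathSegment D X) := (P.map rev).reverse

theorem Connects.reverse (h : Connects P z z') : Connects (revPath P) z' z := by
  induction P generalizing z with
  | nil => exact Eq.symm h
  | cons s P ih =>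
    rw [revPath, List.map_cons, List.reverse_cons]
    exact (ih h.2).append ⟨rfl, h.1⟩

/-- The elements visited by a mapping path `P` starting at `z`. Unlike `visited P`, this list
contains `z` also if `P` is empty. -/
def vertices (z : Elem D X) (P : List (PathSegment D X)) : List (Elem D X) :=
  z :: P.map PathSegment.snd

theorem vertices_append : vertices z (P ++ Q) = vertices z P ++ Q.map PathSegment.snd := by
  simp [vertices]

theorem Connects.end_mem (h : Connects P z z') : z' ∈ vertices z P := by
  induction P generalizing z with
  | nil => exact List.mem_singleton.2 (Eq.symm h)
  | cons s P ih => exact List.mem_cons_of_mem _ (ih h.2)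

theorem Connects.fst_mem (h : Connects P z z') {s : PathSegment D X} (hs : s ∈ P) :
    s.fst ∈ vertices z P := by
  induction P generalizing z with
  | nil => simp at hs
  | cons t P ih =>
    rcases List.mem_cons.1 hs with rfl | hs
    · rw [h.1]
      exact List.mem_cons_self
    · exact List.mem_cons_of_mem _ (ih h.2 hs)

theorem Connects.vertices_reverse (h : Connects P z z') :
    vertices z' (revPath P) = (vertices z P).reverse := by
  induction P generalizing z with
  | nil => rw [show z = z' from h]; rfl
  | cons s P ih =>
    have ih := ih h.2
    simp only [vertices, revPath, List.map_cons, List.reverse_cons, List.map_append] at ih ⊢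
    rw [← List.cons_append, ih, ← h.1]
    rfl

/-- A mapping path from `z` to `z'` that visits no element twice. -/
structure IsSimplePath (P : List (PathSegment D X)) (z z' : Elem D X) : Prop where
  connects : Connects P z z'
  nodup : (vertices z P).Nodup

namespace IsSimplePath

theorem nil (z : Elem D X) : IsSimplePath [] z z := ⟨rfl, List.nodup_singleton z⟩

theorem cons {s : PathSegment D X} (hP : IsSimplePath P s.snd z')
    (hs : s.fst ∉ vertices s.snd P) : IsSimplePath (s :: P) s.fst z' :=
  ⟨⟨rfl, hP.connects⟩, List.nodup_cons.2 ⟨hs, hP.nodup⟩⟩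

theorem reverse (hP : IsSimplePath P z z') : IsSimplePath (revPath P) z' z where
  connects := hP.connects.reverse
  nodup := by
    rw [hP.connects.vertices_reverse]
    exact List.nodup_reverse.2 hP.nodup

theorem append (hP : IsSimplePath P z m) (hQ : IsSimplePath Q m z')
    (hPQ : ∀ e ∈ vertices z P, e ∉ Q.map PathSegment.snd) : IsSimplePath (P ++ Q) z z' where
  connects := hP.connects.append hQ.connects
  nodup := by
    rw [vertices_append]
    exact hP.nodup.append (List.nodup_cons.1 hQ.nodup).2 fun e => hPQ e

theorem prolong {R R' : List (PathSegment D X)} {c c' : Elem D X} (hR : IsSimplePath R c z)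
    (hP : IsSimplePath P c c') (hR' : IsSimplePath R' c' z')
    (hRP : ∀ e ∈ R.map PathSegment.snd, e ∉ vertices c P)
    (hPR' : ∀ e ∈ vertices c P, e ∉ R'.map PathSegment.snd)
    (hRR' : ∀ e ∈ vertices c R, e ∉ vertices c' R') :
    IsSimplePath (revPath R ++ (P ++ R')) z z' := by
  refine hR.reverse.append (hP.append hR' hPR') fun e he hePR' => ?_
  rw [hR.connects.vertices_reverse, List.mem_reverse] at he
  rw [List.map_append, List.mem_append] at hePR'
  rcases hePR' with heP | heR'
  · rcases List.mem_cons.1 he with rfl | heR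
    · exact (List.nodup_cons.1 hP.nodup).1 heP
    · exact hRP e heR (List.mem_cons_of_mem _ heP)
  · exact hRR' e he (List.mem_cons_of_mem _ heR')

theorem isProper (hP : IsSimplePath P z z') : IsProper P := by
  obtain ⟨h, hnd⟩ := hP
  induction P generalizing z with
  | nil => exact List.Pairwise.nil
  | cons s P ih =>
    obtain ⟨hz, hnd⟩ := List.nodup_cons.1 hnd
    refine List.Pairwise.cons (fun t ht hst => ?_) (ih h.2 hnd)
    rcases hst with rfl | ⟨hst, -, -⟩
    · exact (List.nodup_cons.1 hnd).1 (List.mem_map_of_mem ht)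
    · refine hz (List.mem_cons_of_mem _ ?_)
      rw [← h.1, hst]
      exact List.mem_map_of_mem ht

theorem isInnerCycleFree (hP : IsSimplePath P z z') : IsInnerCycleFree P := by
  intro i j hij hj hlt
  cases P with
  | nil => simp at hlt
  | cons s P =>
    have hv : visited (s :: P) = vertices z (s :: P) := by rw [visited, hP.connects.1, vertices]
    have hi : i < (vertices z (s :: P)).length := by
      simp only [vertices, List.length_cons, List.length_map] at hj ⊢
      lia
    rw [hv]
    exact fun h => hij.ne ((List.getElem?_inj hi hP.nodup).1 h)

end IsSimplePath

end PathCalculus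

/-! ### The graph of elements -/

section Step

variable {I : Type u₁} [Quiver.{v₁} I] {B : Type u} [Category.{v} B]
  {D : Diagram I (B ⥤ Type w)} {X : B}

/-- The edge relation of the graph of elements: some edge of `I` sends the first element to the
second one. -/
inductive Step : Elem D X → Elem D X → Prop
  | intro {i j : I} (d : i ⟶ j) (y : (D.obj i).obj X) : Step ⟨i, y⟩ ⟨j, edgeMap D X d y⟩

theorem Step.exists_connects {e e' : Elem D X} (h : Step e e') : ∃ P, Connects P e e' := by
  obtain ⟨d, y⟩ := h
  exact ⟨_, connects_singleton (.forward d y)⟩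

theorem exists_connects_of_eqvGen {e e' : Elem D X} (h : Relation.EqvGen Step e e') :
    ∃ P, Connects P e e' := by
  induction h with
  | rel _ _ h => exact h.exists_connects
  | refl e => exact ⟨[], rfl⟩
  | symm _ _ _ ih => exact ih.imp' revPath fun _ h => h.reverse
  | trans _ _ _ _ _ ih ih' =>
    obtain ⟨P, hP⟩ := ih
    obtain ⟨P', hP'⟩ := ih'
    exact ⟨P ++ P', hP.append hP'⟩

theorem exists_pathMap_eq {e e' : Elem D X} (h : Relation.ReflTransGen Step e e') :
    ∃ p : Quiver.Path e.1 e'.1, pathMap D X p e.2 = e'.2 := by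
  induction h with
  | refl => exact ⟨.nil, rfl⟩
  | tail _ h ih =>
    obtain ⟨d, y⟩ := h
    obtain ⟨p, hp⟩ := ih
    exact ⟨p.cons d, by rw [pathMap, hp]⟩

theorem pathMap_toPath_comp {i j k : I} (d : i ⟶ j) (p : Quiver.Path j k)
    (y : (D.obj i).obj X) :
    pathMap D X (d.toPath.comp p) y = pathMap D X p (edgeMap D X d y) := by
  induction p with
  | nil => rfl
  | cons p e ih => rw [Quiver.Path.comp_cons, pathMap, ih]; rfl

end Step

section Descent

variable {I : Type u₁} [Quiver.{v₁} I]

theorem NoDirectedCycles.not_transGen_self (hI : NoDirectedCycles I) (i : I) :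
    ¬ Relation.TransGen (fun i j : I => Nonempty (j ⟶ i)) i i := by
  have exists_path {j : I} (h : Relation.TransGen (fun i j : I => Nonempty (j ⟶ i)) i j) :
      ∃ p : Quiver.Path j i, p.length ≠ 0 := by
    induction h with
    | single h => exact ⟨h.some.toPath, by simp⟩
    | tail _ h ih => exact ⟨h.some.toPath.comp ih.choose, by simp⟩
  intro h
  obtain ⟨p, hp⟩ := exists_path h
  exact hp (by rw [hI i p]; rfl)

theorem NoDirectedCycles.wellFounded [Finite I] (hI : NoDirectedCycles I) :
    WellFounded fun i j : I => Nonempty (j ⟶ i) := by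
  have : Std.Irrefl (Relation.TransGen fun i j : I => Nonempty (j ⟶ i)) :=
    ⟨hI.not_transGen_self⟩
  exact Subrelation.wf (fun h => .single h) (Finite.wellFounded_of_trans_of_irrefl
    (Relation.TransGen fun i j : I => Nonempty (j ⟶ i)))

theorem edge_eq_of_toPath_comp_eq {i j j' k : I} {d : i ⟶ j} {d' : i ⟶ j'} {p : Quiver.Path j k}
    {p' : Quiver.Path j' k} (h : d.toPath.comp p = d'.toPath.comp p') :
    (⟨j, d⟩ : Σ k : I, i ⟶ k) = ⟨j', d'⟩ := by
  induction p with
  | nil =>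
    cases p' with
    | nil => cases h; rfl
    | cons p' e' =>
      have hlen := congrArg Quiver.Path.length h
      simp [Quiver.Path.length_comp] at hlen
  | cons p e ih =>
    cases p' with
    | nil =>
      have hlen := congrArg Quiver.Path.length h
      simp [Quiver.Path.length_comp] at hlen
    | cons p' e' =>
      obtain ⟨rfl, h, -⟩ := Quiver.Path.cons.inj h
      exact ih (eq_of_heq h)

variable (hI : WellFounded fun i j : I => Nonempty (j ⟶ i))
  {B : Type u} [Category.{v} B] {D : Diagram I (B ⥤ Type w)} {X : B}

include hI

theorem wellFounded_swap_step : WellFounded (Function.swap (Step (D := D) (X := X))) :=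
  Subrelation.wf (fun h => by obtain ⟨d, -⟩ := h; exact ⟨d⟩) (InvImage.wf Sigma.fst hI)

theorem not_transGen_step_self (e : Elem D X) : ¬ Relation.TransGen Step e e := fun h =>
  (wellFounded_swap_step hI).transGen.irrefl.irrefl e (Relation.transGen_swap.2 h)

theorem exists_descent (a : Elem D X) :
    ∃ m P, IsMinimal m.1 ∧ IsSimplePath P a m ∧
      ∀ e ∈ P.map PathSegment.snd, Relation.TransGen Step a e := by
  induction a using (wellFounded_swap_step hI).induction with
  | _ a ih =>
  obtain ⟨i, y⟩ := a
  by_cases hi : IsMinimal i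
  · exact ⟨⟨i, y⟩, [], hi, .nil _, by simp⟩
  · obtain ⟨j, ⟨d⟩⟩ : ∃ j, Nonempty (i ⟶ j) := by simpa [IsMinimal] using hi
    obtain ⟨m, P, hm, hP, hlt⟩ := ih _ (Step.intro d y)
    have hlt' : ∀ e ∈ vertices ⟨j, edgeMap D X d y⟩ P, Relation.TransGen Step ⟨i, y⟩ e := by
      intro e he
      rcases List.mem_cons.1 he with rfl | he
      · exact .single (.intro d y)
      · exact .head (.intro d y) (hlt e he)
    exact ⟨m, _, hm, hP.cons (s := .forward d y) fun h => not_transGen_step_self hI _ (hlt' _ h),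
      hlt'⟩

theorem exists_exit_path (V : Set (Elem D X)) {a : Elem D X} (ha : a ∈ V) :
    ∃ c ∈ V, ∃ m P, IsMinimal m.1 ∧ IsSimplePath P c m ∧
      (∀ e ∈ vertices c P, Relation.ReflTransGen Step a e) ∧
      ∀ e ∈ P.map PathSegment.snd, e ∉ V := by
  induction a using (wellFounded_swap_step hI).transGen.induction with
  | _ a ih =>
  by_cases h : ∃ b ∈ V, Relation.TransGen Step a b
  · obtain ⟨b, hb, hab⟩ := h
    obtain ⟨c, hc, m, P, hm, hP, hbP, hPV⟩ := ih b (Relation.transGen_swap.2 hab) hb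
    exact ⟨c, hc, m, P, hm, hP, fun e he => hab.to_reflTransGen.trans (hbP e he), hPV⟩
  · obtain ⟨m, P, hm, hP, hlt⟩ := exists_descent hI a
    refine ⟨a, ha, m, P, hm, hP, fun e he => ?_, fun e he heV => h ⟨e, heV, hlt e he⟩⟩
    rcases List.mem_cons.1 he with rfl | he
    · exact .refl
    · exact (hlt e he).to_reflTransGen

theorem ImageDisjoint.not_reflTransGen_step (hD : ImageDisjoint D) {i j j' : I} {d : i ⟶ j}
    {d' : i ⟶ j'} (hd : (⟨j, d⟩ : Σ k : I, i ⟶ k) ≠ ⟨j', d'⟩) (y : (D.obj i).obj X)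
    {e : Elem D X} (h : Relation.ReflTransGen Step ⟨j, edgeMap D X d y⟩ e) :
    ¬ Relation.ReflTransGen Step ⟨j', edgeMap D X d' y⟩ e := fun h' => by
  obtain ⟨m, P, hm, hP, hlt⟩ := exists_descent hI e
  have hem : Relation.ReflTransGen Step e m := by
    rcases List.mem_cons.1 hP.connects.end_mem with rfl | hmP
    exacts [.refl, (hlt m hmP).to_reflTransGen]
  obtain ⟨p, hp⟩ := exists_pathMap_eq (h.trans hem)
  obtain ⟨p', hp'⟩ := exists_pathMap_eq (h'.trans hem)
  refine hD i m.1 m.1 (d.toPath.comp p) (d'.toPath.comp p') ⟨_, _, hd⟩ hm hm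
    (fun h => hd (edge_eq_of_toPath_comp_eq (eq_of_heq (Sigma.mk.inj h).2))) X y ?_
  rw [pathMap_toPath_comp, pathMap_toPath_comp, hp, hp']

end Descent

/-! ### Simple closed paths -/

section SimpleClosed

variable {I : Type u₁} [Quiver.{v₁} I] {B : Type u} [Category.{v} B]
  {D : Diagram I (B ⥤ Type w)} {X : B}

/-- A nonempty proper closed mapping path at `z` that visits no element twice, except that it ends
where it starts. -/
structure IsSimpleClosed (P : List (PathSegment D X)) (z : Elem D X) : Prop where
  ne_nil : P ≠ []
  connects : Connects P z z
  isProper : IsProper P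
  nodup : (P.map PathSegment.snd).Nodup

namespace IsSimpleClosed

variable {P A R : List (PathSegment D X)} {z m : Elem D X}

theorem vertices_subset (h : IsSimpleClosed P z) : vertices z P ⊆ P.map PathSegment.snd := by
  obtain ⟨hne, hc, -, -⟩ := h
  cases P with
  | nil => exact absurd rfl hne
  | cons s P => exact List.cons_subset.2 ⟨hc.2.end_mem, List.Subset.refl _⟩

theorem rotate (h : IsSimpleClosed (A ++ R) z) (hA : Connects A z m) (hR : Connects R m z) :
    IsSimpleClosed (R ++ A) m where
  ne_nil := by simpa [and_comm] using h.ne_nil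
  connects := hR.append hA
  isProper := isProper_iff_nodup.2 <|
    (List.perm_append_comm.map _).nodup_iff.1 (isProper_iff_nodup.1 h.isProper)
  nodup := (List.perm_append_comm.map _).nodup_iff.1 h.nodup

theorem exists_split (h : IsSimpleClosed P z) (hm : m ∈ P.map PathSegment.snd) :
    ∃ A R, P = A ++ R ∧ A ≠ [] ∧ Connects A z m ∧ Connects R m z := by
  obtain ⟨s, hs, rfl⟩ := List.mem_map.1 hm
  obtain ⟨L, R, rfl⟩ := List.append_of_mem hs
  obtain ⟨_, hL, rfl, hR⟩ := connects_append.1 h.connects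
  exact ⟨L ++ [s], R, by simp, by simp, hL.append (connects_singleton s), hR⟩

theorem exists_rotate (h : IsSimpleClosed P z) (hm : m ∈ P.map PathSegment.snd) :
    ∃ Q, IsSimpleClosed Q m ∧ ∀ e, e ∈ Q.map PathSegment.snd ↔ e ∈ P.map PathSegment.snd := by
  obtain ⟨A, R, rfl, -, hA, hR⟩ := h.exists_split hm
  exact ⟨R ++ A, h.rotate hA hR, fun e => (List.perm_append_comm.map _).mem_iff⟩

theorem isSimplePath_left (h : IsSimpleClosed (A ++ R) z) (hA : Connects A z m)
    (hR : Connects R m z) (hne : z ≠ m) : IsSimplePath A z m := by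
  have hnd := h.nodup
  rw [List.map_append, List.nodup_append'] at hnd
  obtain ⟨hA', -, hdisj⟩ := hnd
  have hz : z ∈ R.map PathSegment.snd := (List.mem_cons.1 hR.end_mem).resolve_left hne
  exact ⟨hA, List.nodup_cons.2 ⟨fun hzA => hdisj hzA hz, hA'⟩⟩

theorem ne_revPath (h : IsSimpleClosed (A ++ R) z) (hA : A ≠ []) : A ≠ revPath R := by
  rintro rfl
  obtain ⟨s, hs⟩ := List.exists_mem_of_ne_nil _ hA
  obtain ⟨t, ht, rfl⟩ : ∃ t ∈ R, t.rev = s := by simpa [revPath] using hs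
  exact (List.pairwise_append.1 h.isProper).2.2 _ hs t ht (weaklyEqual_iff_key_eq.2 t.key_rev)

theorem exists_arcs (h : IsSimpleClosed P z) (hm : m ∈ P.map PathSegment.snd) (hne : z ≠ m) :
    ∃ A A', A ≠ A' ∧
      (IsSimplePath A z m ∧ vertices z A ⊆ P.map PathSegment.snd) ∧
      (IsSimplePath A' z m ∧ vertices z A' ⊆ P.map PathSegment.snd) := by
  obtain ⟨A, R, rfl, hAne, hA, hR⟩ := h.exists_split hm
  have h' := h.rotate hA hR
  refine ⟨A, revPath R, h.ne_revPath hAne, ⟨h.isSimplePath_left hA hR hne, ?_⟩,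
    (h'.isSimplePath_left hR hA hne.symm).reverse, ?_⟩
  · refine List.Subset.trans ?_ h.vertices_subset
    rw [vertices_append]
    exact List.subset_append_left _ _
  · rw [hR.vertices_reverse, List.reverse_subset]
    refine List.Subset.trans ?_ ((List.perm_append_comm.map _).subset)
    refine List.Subset.trans ?_ h'.vertices_subset
    rw [vertices_append]
    exact List.subset_append_left _ _

theorem exists_source_mem (hirrefl : ∀ e : Elem D X, ¬ Relation.TransGen Step e e)
    (h : IsSimpleClosed P z) :
    ∃ m ∈ P.map PathSegment.snd, ∀ e ∈ P.map PathSegment.snd, ¬ Step e m := by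
  have : IsStrictOrder (Elem D X) (Relation.TransGen Step) :=
    { irrefl := hirrefl, trans := fun _ _ _ => .trans }
  let := partialOrderOfSO (Relation.TransGen (Step (D := D) (X := X)))
  have hne : {e | e ∈ P.map PathSegment.snd}.Nonempty := ⟨z, h.vertices_subset List.mem_cons_self⟩
  obtain ⟨m, hm⟩ := (List.finite_toSet (P.map PathSegment.snd)).exists_minimal hne
  exact ⟨m, hm.1, fun e he hem => hm.not_lt he (.single hem)⟩

theorem exists_edges_of_not_step (h : IsSimpleClosed P z)
    (hz : ∀ e ∈ P.map PathSegment.snd, ¬ Step e z) :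
    ∃ (i j j' : I) (d : i ⟶ j) (d' : i ⟶ j') (y : (D.obj i).obj X),
      (⟨j, d⟩ : Σ k : I, i ⟶ k) ≠ ⟨j', d'⟩ ∧
      ⟨j, edgeMap D X d y⟩ ∈ P.map PathSegment.snd ∧
      ⟨j', edgeMap D X d' y⟩ ∈ P.map PathSegment.snd := by
  obtain ⟨s, hs, hsz⟩ : ∃ s ∈ P, s.fst = z := by
    obtain ⟨s, P, rfl⟩ := List.exists_cons_of_ne_nil h.ne_nil
    exact ⟨s, List.mem_cons_self, h.connects.1⟩
  obtain ⟨t, ht, htz⟩ : ∃ t ∈ P, t.snd = z :=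
    List.mem_map.1 (h.vertices_subset List.mem_cons_self)
  have hs' : s.snd ∈ P.map PathSegment.snd := List.mem_map_of_mem hs
  have ht' : t.fst ∈ P.map PathSegment.snd := h.vertices_subset (h.connects.fst_mem ht)
  cases s using PathSegment.forward_backward_cases with
  | backward d y => exact absurd (hsz ▸ Step.intro d y) (hz _ hs')
  | @forward i j d y =>
  cases t using PathSegment.forward_backward_cases with
  | forward d' y' => exact absurd (htz ▸ Step.intro d' y') (hz _ ht')
  | @backward i' j' d' y' =>
  cases hsz.trans htz.symm
  refine ⟨i, j, j', d, d', y, fun hdd => ?_, hs', ht'⟩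
  have hkey : (PathSegment.forward d y).key = (PathSegment.backward d' y).key := by
    cases hdd
    rfl
  have hst := List.inj_on_of_nodup_map (isProper_iff_nodup.1 h.isProper) hs ht hkey
  exact Sum.inl_ne_inr (congrArg PathSegment.edge hst)

/-- The closed path leaves one of its elements through two different edges of `I`. By
image-disjointness, descents from their targets to minimal indices never meet; prolonging the two
arcs between the last elements of these descents on the closed path gives the two paths. -/
theorem exists_ne_isSimplePath (hI : WellFounded fun i j : I => Nonempty (j ⟶ i))
    (hD : ImageDisjoint D) (h : IsSimpleClosed P z) :
    ∃ (m m' : Elem D X) (Q Q' : List (PathSegment D X)), IsAffected m.1 ∧ IsAffected m'.1 ∧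
      Q ≠ Q' ∧ IsSimplePath Q m m' ∧ IsSimplePath Q' m m' := by
  obtain ⟨p, hp, hpeak⟩ := h.exists_source_mem (not_transGen_step_self hI)
  obtain ⟨P, h, hmem⟩ := h.exists_rotate hp
  obtain ⟨i, j, j', d, d', y, hdd, hj, hj'⟩ :=
    h.exists_edges_of_not_step fun e he => hpeak e ((hmem e).1 he)
  obtain ⟨c, hc, m, R, hm, hR, hjR, hRP⟩ :=
    exists_exit_path hI {e | e ∈ P.map PathSegment.snd} hj
  obtain ⟨c', hc', m', R', hm', hR', hjR', hRP'⟩ :=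
    exists_exit_path hI {e | e ∈ P.map PathSegment.snd} hj'
  have hRR : ∀ e ∈ vertices c R, e ∉ vertices c' R' := fun e he he' =>
    hD.not_reflTransGen_step hI hdd y (hjR e he) (hjR' e he')
  have hcc : c ≠ c' := fun hcc => hRR c List.mem_cons_self (hcc ▸ List.mem_cons_self)
  obtain ⟨Q, hQ, hQP⟩ := h.exists_rotate hc
  obtain ⟨A, A', hne, hA, hA'⟩ := hQ.exists_arcs ((hQP c').2 hc') hcc
  have prolong {A : List (PathSegment D X)}
      (hA : IsSimplePath A c c' ∧ vertices c A ⊆ Q.map PathSegment.snd) :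
      IsSimplePath (revPath R ++ (A ++ R')) m m' :=
    hR.prolong hA.1 hR' (fun e he heA => hRP e he ((hQP e).1 (hA.2 heA)))
      (fun e heA he => hRP' e he ((hQP e).1 (hA.2 heA))) hRR
  have hbr : IsBranching i := ⟨_, _, hdd⟩
  refine ⟨m, m', _, _, ⟨hm, i, hbr, ?_⟩, ⟨hm', i, hbr, ?_⟩, fun heq => hne ?_,
    prolong hA, prolong hA'⟩
  · exact ⟨d.toPath.comp (exists_pathMap_eq (hjR m hR.connects.end_mem)).choose⟩
  · exact ⟨d'.toPath.comp (exists_pathMap_eq (hjR' m' hR'.connects.end_mem)).choose⟩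
  · exact List.append_cancel_right (List.append_cancel_left heq)

end IsSimpleClosed

end SimpleClosed

/-! ### The pullback functor of a cocone -/

section PullbackFunctor

variable {I : Type u₁} [Quiver.{v₁} I] {C : Type u} [Category.{v} C]

/-- The evaluation functor `D ↦ D_i` on diagrams. -/
def evaluation (C : Type u) [Category.{v} C] (i : I) : Diagram I C ⥤ C where
  obj D := D.obj i
  map f := Hom.app f i

theorem isIso_of_isIso_app {E F : Diagram I C} (f : E ⟶ F) (h : ∀ i, IsIso (Hom.app f i)) :
    IsIso f :=
  ⟨{ app := fun i => inv (Hom.app f i)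
     naturality := fun d => by
      rw [IsIso.comp_inv_eq, Category.assoc, f.naturality, IsIso.inv_hom_id_assoc] },
    hom_ext fun i => IsIso.hom_inv_id _, hom_ext fun i => IsIso.inv_hom_id _⟩

theorem isCartesian_of_isPullback_leg {D E : Diagram I C} {S K : C} {κ : D ⟶ (const I C).obj S}
    {τ : E ⟶ D} {ρ : E ⟶ (const I C).obj K} {k : K ⟶ S}
    (h : ∀ i, IsPullback (Hom.app τ i) (leg ρ i) (leg κ i) k) : IsCartesian τ := fun {i j} d => by
  refine .of_right ?_ (τ.naturality d) (h j).flip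
  rw [leg_w, leg_w]
  exact (h i).flip

variable [HasPullbacks C] {D : Diagram I C} {S : C} {κ : D ⟶ (const I C).obj S}

/-- The projections of the pullbacks of `σ : K → S` onto `K`, as a cocone with vertex `K`. -/
noncomputable def pullbackProj (κ : D ⟶ (const I C).obj S) (σ : Over S) :
    pullbackDiagram κ σ ⟶ (const I C).obj σ.left where
  app i := pullback.snd (leg κ i) σ.hom
  naturality d := (pullbackEdge_snd κ σ d).trans (Category.comp_id _).symm

theorem pullbackMap_pullbackHom {σ σ' : Over S} (γ : σ ⟶ σ') :
    pullbackMap κ γ ≫ pullbackHom κ σ' = pullbackHom κ σ :=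
  hom_ext fun i => pullbackComp_fst κ γ i

theorem pullbackMap_pullbackProj {σ σ' : Over S} (γ : σ ⟶ σ') :
    pullbackMap κ γ ≫ pullbackProj κ σ' = pullbackProj κ σ ≫ (const I C).map γ.left :=
  hom_ext fun i => pullbackComp_snd κ γ i

theorem pullbackProj_comp_const_map (σ : Over S) :
    pullbackProj κ σ ≫ (const I C).map σ.hom = pullbackHom κ σ ≫ κ :=
  hom_ext fun _ => pullback.condition.symm

theorem pullbackDiagram_hom_ext {E : Diagram I C} {σ : Over S} {α β : E ⟶ pullbackDiagram κ σ}
    (h₁ : α ≫ pullbackHom κ σ = β ≫ pullbackHom κ σ)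
    (h₂ : α ≫ pullbackProj κ σ = β ≫ pullbackProj κ σ) : α = β :=
  hom_ext fun i => pullback.hom_ext (congrArg (fun f : E ⟶ D => Hom.app f i) h₁)
    (congrArg (fun f : E ⟶ (const I C).obj σ.left => leg f i) h₂)

theorem pullbackFunctor_faithful (h : ∀ σ : Over S, IsColimiting (pullbackProj κ σ)) :
    (pullbackFunctor κ).Faithful where
  map_injective {σ σ'} γ γ' hγ := by
    have hγ : pullbackMap κ γ = pullbackMap κ γ' :=
      congrArg (fun f : (pullbackFunctor κ).obj σ ⟶ (pullbackFunctor κ).obj σ' => f.hom.left) hγ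
    refine Over.OverMorphism.ext ((h σ _ _).unique (pullbackMap_pullbackProj γ).symm ?_)
    rw [hγ]
    exact (pullbackMap_pullbackProj γ').symm

theorem pullbackFunctor_full (h : ∀ σ : Over S, IsColimiting (pullbackProj κ σ)) :
    (pullbackFunctor κ).Full where
  map_surjective {σ σ'} f := by
    let φ : pullbackDiagram κ σ ⟶ pullbackDiagram κ σ' := f.hom.left
    have hφ : φ ≫ pullbackHom κ σ' = pullbackHom κ σ := Over.w f.hom
    obtain ⟨t, ht, -⟩ := h σ _ (φ ≫ pullbackProj κ σ')
    have hw : t ≫ σ'.hom = σ.hom := by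
      refine (h σ _ (pullbackHom κ σ ≫ κ)).unique ?_ (pullbackProj_comp_const_map σ)
      rw [Functor.map_comp, ← Category.assoc, ht, Category.assoc, pullbackProj_comp_const_map,
        ← Category.assoc, hφ]
    let γ : σ ⟶ σ' := Over.homMk t hw
    have hγ : pullbackMap κ γ = φ := pullbackDiagram_hom_ext
      ((pullbackMap_pullbackHom γ).trans hφ.symm) ((pullbackMap_pullbackProj γ).trans ht)
    exact ⟨γ, ObjectProperty.hom_ext _ (Over.OverMorphism.ext hγ)⟩

theorem isPullback_pullbackHom (σ : Over S) (i : I) :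
    IsPullback (Hom.app (pullbackHom κ σ) i) (leg (pullbackProj κ σ) i) (leg κ i) σ.hom :=
  .of_hasPullback _ _

/-- The natural transformation into the diagram of pullbacks that is induced by a transformation
into `D` and a cocone with vertex `K`. -/
noncomputable def pullbackLift {E : Diagram I C} {σ : Over S} (τ : E ⟶ D)
    (ρ : E ⟶ (const I C).obj σ.left) (h : ∀ i, Hom.app τ i ≫ leg κ i = leg ρ i ≫ σ.hom) :
    E ⟶ pullbackDiagram κ σ where
  app i := pullback.lift (Hom.app τ i) (leg ρ i) (h i)
  naturality {i j} d := by
    change E.map d ≫ pullback.lift _ _ (h j) = pullback.lift _ _ (h i) ≫ pullbackEdge κ σ d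
    apply pullback.hom_ext
    · rw [Category.assoc, Category.assoc, pullbackEdge_fst, pullback.lift_fst,
        pullback.lift_fst_assoc, τ.naturality]
    · rw [Category.assoc, Category.assoc, pullbackEdge_snd, pullback.lift_snd, pullback.lift_snd,
        leg_w]

theorem mem_essImage_pullbackFunctor_iff (F : CartesianOver D) :
    (pullbackFunctor κ).essImage F ↔ ∃ (K : C) (k : K ⟶ S) (ρ : F.obj.left ⟶ (const I C).obj K),
      ∀ i, IsPullback (Hom.app F.obj.hom i) (leg ρ i) (leg κ i) k := by
  constructor
  · rintro ⟨σ, ⟨Φ⟩⟩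
    let e : pullbackDiagram κ σ ≅ F.obj.left :=
      (Over.forget D).mapIso ((ObjectProperty.ι _).mapIso Φ)
    have he : e.hom ≫ F.obj.hom = pullbackHom κ σ := Over.w Φ.hom.hom
    refine ⟨σ.left, σ.hom, e.inv ≫ pullbackProj κ σ, fun i => ?_⟩
    have hi : Hom.app e.hom i ≫ Hom.app e.inv i = 𝟙 _ := ((evaluation C i).mapIso e).hom_inv_id
    refine (isPullback_pullbackHom σ i).of_iso ((evaluation C i).mapIso e) (Iso.refl _)
      (Iso.refl _) (Iso.refl _) ?_ ?_ (by simp) (by simp)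
    · exact (Category.comp_id _).trans (congrArg (evaluation C i).map he.symm)
    · refine (Category.comp_id _).trans ?_
      change _ = Hom.app e.hom i ≫ Hom.app e.inv i ≫ leg (pullbackProj κ σ) i
      rw [← Category.assoc, hi, Category.id_comp]
  · rintro ⟨K, k, ρ, h⟩
    let α := pullbackLift (κ := κ) (σ := Over.mk k) F.obj.hom ρ (fun i => (h i).w)
    have hα (i : I) : Hom.app α i = (h i).isoPullback.hom :=
      pullback.hom_ext ((pullback.lift_fst _ _ _).trans (h i).isoPullback_hom_fst.symm)
        ((pullback.lift_snd _ _ _).trans (h i).isoPullback_hom_snd.symm)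
    have : IsIso α := isIso_of_isIso_app α fun i => by
      rw [hα]
      exact (h i).isoPullback.isIso_hom
    exact ⟨Over.mk k, ⟨(ObjectProperty.isoMk _ (Over.isoMk (g := Over.mk (pullbackHom κ _))
      (asIso α) (hom_ext fun i => pullback.lift_fst _ _ _))).symm⟩⟩

end PullbackFunctor

/-! ### Colimits of presheaves -/

section Presheaf

variable {I : Type u₁} [Quiver.{v₁} I] {B : Type u} [Category.{v} B]
  {D E : Diagram I (B ⥤ Type w)} {X : B}

/-- The action of a morphism of `B` on elements. -/
def restrict {Y : B} (f : X ⟶ Y) (e : Elem D X) : Elem D Y := ⟨e.1, (D.obj e.1).map f e.2⟩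

theorem Step.restrict {Y : B} (f : X ⟶ Y) {e e' : Elem D X} (h : Step e e') :
    Step (restrict f e) (restrict f e') := by
  obtain ⟨d, y⟩ := h
  have hd : edgeMap D Y d ((D.obj _).map f y) = (D.obj _).map f (edgeMap D X d y) :=
    NatTrans.naturality_apply (D.map d) f y
  simpa only [GraphVK.restrict, hd] using Step.intro d ((D.obj _).map f y)

theorem restrict_id (e : Elem D X) : restrict (𝟙 X) e = e := by simp [restrict]

theorem restrict_comp {Y Z : B} (f : X ⟶ Y) (g : Y ⟶ Z) (e : Elem D X) :
    restrict (f ≫ g) e = restrict g (restrict f e) :=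
  congrArg (Sigma.mk e.1) (ConcreteCategory.congr_hom ((D.obj e.1).map_comp f g) e.2)

/-- The map on elements induced by a natural transformation of diagrams. -/
def elemMap (τ : E ⟶ D) (e : Elem E X) : Elem D X := ⟨e.1, (Hom.app τ e.1).app X e.2⟩

theorem elemMap_edgeMap (τ : E ⟶ D) {i j : I} (d : i ⟶ j) (x : (E.obj i).obj X) :
    elemMap τ ⟨j, edgeMap E X d x⟩ = ⟨j, edgeMap D X d ((Hom.app τ i).app X x)⟩ :=
  congrArg (fun f : E.obj i ⟶ D.obj j => (⟨j, f.app X x⟩ : Elem D X)) (Hom.naturality τ d)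

theorem exists_step_of_step_elemMap (τ : E ⟶ D) {e : Elem E X} {z : Elem D X}
    (h : Step (elemMap τ e) z) : ∃ e', Step e e' ∧ elemMap τ e' = z := by
  obtain ⟨i, x⟩ := e
  obtain ⟨d, -⟩ := h
  exact ⟨_, .intro d x, elemMap_edgeMap τ d x⟩

theorem Diagram.IsCartesian.exists_step {τ : E ⟶ D} (hτ : IsCartesian τ) {e : Elem E X}
    {z : Elem D X} (h : Step z (elemMap τ e)) : ∃ e', Step e' e ∧ elemMap τ e' = z := by
  obtain ⟨j, x⟩ := e
  generalize hx : elemMap τ ⟨j, x⟩ = z' at h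
  obtain ⟨d, y⟩ := h
  obtain rfl : j = _ := congrArg Sigma.fst hx
  obtain ⟨x', rfl, rfl⟩ := Types.exists_of_isPullback ((hτ d).app X) x y
    (eq_of_heq (Sigma.mk.inj hx).2)
  exact ⟨_, .intro d x', rfl⟩

theorem Diagram.IsCartesian.exists_eqvGen {τ : E ⟶ D} (hτ : IsCartesian τ) {e : Elem E X}
    {z : Elem D X} (h : Relation.EqvGen Step (elemMap τ e) z) :
    ∃ e', Relation.EqvGen Step e e' ∧ elemMap τ e' = z := by
  suffices H : ∀ {z z' : Elem D X}, Relation.EqvGen Step z z' →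
      (∀ e, elemMap τ e = z → ∃ e', Relation.EqvGen Step e e' ∧ elemMap τ e' = z') ∧
        ∀ e, elemMap τ e = z' → ∃ e', Relation.EqvGen Step e e' ∧ elemMap τ e' = z from
    (H h).1 e rfl
  intro z z' h
  induction h with
  | rel z z' h =>
    constructor
    · rintro e rfl
      obtain ⟨e', he, he'⟩ := exists_step_of_step_elemMap τ h
      exact ⟨e', .rel _ _ he, he'⟩
    · rintro e rfl
      obtain ⟨e', he, he'⟩ := hτ.exists_step h
      exact ⟨e', .symm _ _ (.rel _ _ he), he'⟩
  | refl z => exact ⟨fun e he => ⟨e, .refl e, he⟩, fun e he => ⟨e, .refl e, he⟩⟩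
  | symm _ _ _ ih => exact ih.symm
  | trans _ _ _ _ _ ih ih' =>
    constructor
    · intro e he
      obtain ⟨e', h, he'⟩ := ih.1 e he
      exact (ih'.1 e' he').imp fun _ => .imp_left (h.trans _ _ _)
    · intro e he
      obtain ⟨e', h, he'⟩ := ih'.2 e he
      exact (ih.2 e' he').imp fun _ => .imp_left (h.trans _ _ _)

theorem isPullback_of_elements {F₁ F₂ F₃ F₄ : B ⥤ Type w} {t : F₁ ⟶ F₂} {l : F₁ ⟶ F₃}
    {r : F₂ ⟶ F₄} {b : F₃ ⟶ F₄} (w : t ≫ r = l ≫ b)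
    (hinj : ∀ (Y : B) (x x' : F₁.obj Y), t.app Y x = t.app Y x' → l.app Y x = l.app Y x' → x = x')
    (hsurj : ∀ (Y : B) (x₂ : F₂.obj Y) (x₃ : F₃.obj Y), r.app Y x₂ = b.app Y x₃ →
      ∃ x, t.app Y x = x₂ ∧ l.app Y x = x₃) : IsPullback t l r b := by
  refine .of_forall_isPullback_app fun Y => (Types.isPullback_iff _ _ _ _).2 ⟨?_, ?_, hsurj Y⟩
  · rw [← NatTrans.comp_app, w, NatTrans.comp_app]
  · exact fun x x' h => hinj Y x x' h.1 h.2

variable {S : B ⥤ Type w}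

/-- The map on elements of sort `X` given by the components of a cocone. -/
def legMap (κ : D ⟶ (const I (B ⥤ Type w)).obj S) (e : Elem D X) : S.obj X :=
  (leg κ e.1).app X e.2

theorem legMap_restrict (κ : D ⟶ (const I (B ⥤ Type w)).obj S) {Y : B} (f : X ⟶ Y)
    (e : Elem D X) : legMap κ (restrict f e) = S.map f (legMap κ e) :=
  NatTrans.naturality_apply (leg κ e.1) f e.2

theorem Step.legMap_eq (κ : D ⟶ (const I (B ⥤ Type w)).obj S) {e e' : Elem D X} (h : Step e e') :
    legMap κ e = legMap κ e' := by
  obtain ⟨d, y⟩ := h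
  exact congrArg (fun f : D.obj _ ⟶ S => f.app X y) (leg_w κ d).symm

theorem legMap_eq_of_eqvGen (κ : D ⟶ (const I (B ⥤ Type w)).obj S) {e e' : Elem D X}
    (h : Relation.EqvGen Step e e') : legMap κ e = legMap κ e' := by
  induction h with
  | rel _ _ h => exact h.legMap_eq κ
  | refl _ => rfl
  | symm _ _ _ ih => exact ih.symm
  | trans _ _ _ _ _ ih ih' => exact ih.trans ih'

/-- The cocone given by a family of maps on elements that are natural and constant on the
connected components of the graphs of elements. -/
def coconeOfElements (φ : ∀ X, Elem D X → S.obj X)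
    (hstep : ∀ X e e', Step e e' → φ X e = φ X e')
    (hφ : ∀ {X Y : B} (f : X ⟶ Y) (e : Elem D X), φ Y (restrict f e) = S.map f (φ X e)) :
    D ⟶ (const I (B ⥤ Type w)).obj S where
  app i := { app X := ↾fun y => φ X ⟨i, y⟩, naturality X Y f := by ext y; exact hφ f ⟨i, y⟩ }
  naturality {i j} d := by
    refine NatTrans.ext (funext fun X => ?_)
    ext y
    exact (hstep X _ _ (.intro d y)).symm

theorem Diagram.cocone_ext {κ ρ : D ⟶ (const I (B ⥤ Type w)).obj S}
    (h : ∀ (X : B) (e : Elem D X), legMap κ e = legMap ρ e) : κ = ρ := by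
  refine hom_ext fun i => NatTrans.ext (funext fun X => ?_)
  ext y
  exact h X ⟨i, y⟩

theorem legMap_elemMap {κ : D ⟶ (const I (B ⥤ Type w)).obj S} {τ : E ⟶ D} {K : B ⥤ Type w}
    {ρ : E ⟶ (const I (B ⥤ Type w)).obj K} {k : K ⟶ S}
    (h : ∀ i, Hom.app τ i ≫ leg κ i = leg ρ i ≫ k) (e : Elem E X) :
    legMap κ (elemMap τ e) = k.app X (legMap ρ e) :=
  congrArg (fun f : E.obj e.1 ⟶ S => f.app X e.2) (h e.1)

theorem eq_of_elemMap_eq_of_legMap_eq {κ : D ⟶ (const I (B ⥤ Type w)).obj S} {τ : E ⟶ D}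
    {K : B ⥤ Type w} {ρ : E ⟶ (const I (B ⥤ Type w)).obj K} {k : K ⟶ S}
    (h : ∀ i, IsPullback (Hom.app τ i) (leg ρ i) (leg κ i) k) {e e' : Elem E X}
    (hτ : elemMap τ e = elemMap τ e') (hρ : legMap ρ e = legMap ρ e') : e = e' := by
  obtain ⟨i, x⟩ := e
  obtain ⟨j, x'⟩ := e'
  obtain rfl : i = j := congrArg Sigma.fst hτ
  exact congrArg _ (Types.ext_of_isPullback ((h i).app X) (eq_of_heq (Sigma.mk.inj hτ).2) hρ)

theorem isColimiting_of_legMap {κ : D ⟶ (const I (B ⥤ Type w)).obj S}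
    (hsurj : ∀ X : B, Function.Surjective (legMap κ (X := X)))
    (hinj : ∀ (X : B) (e e' : Elem D X), legMap κ e = legMap κ e' → Relation.EqvGen Step e e') :
    IsColimiting κ := by
  intro T ρ
  let g (X : B) := Function.surjInv (hsurj X)
  have hg {X : B} (e : Elem D X) : legMap ρ (g X (legMap κ e)) = legMap ρ e :=
    legMap_eq_of_eqvGen ρ (hinj X _ _ (Function.surjInv_eq (hsurj X) _))
  let t : S ⟶ T :=
    { app X := ↾fun s => legMap ρ (g X s)
      naturality X Y f := by
        ext s
        obtain ⟨e, rfl⟩ := hsurj X s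
        simp [← legMap_restrict, hg] }
  refine ⟨t, cocone_ext fun X e => hg e, fun t' ht' => NatTrans.ext (funext fun X => ?_)⟩
  ext s
  obtain ⟨e, rfl⟩ := hsurj X s
  refine Eq.trans ?_ (hg e).symm
  exact congrArg (fun ρ : D ⟶ (const I (B ⥤ Type w)).obj T => legMap ρ e) ht'

end Presheaf

section Colimit

variable {I : Type u₁} [Quiver.{v₁} I] {B : Type u} [Category.{w} B]
  {D E : Diagram I (B ⥤ Type w)} {S : B ⥤ Type w} {κ : D ⟶ (const I (B ⥤ Type w)).obj S}

/-- The functor of families of truth values indexed by the morphisms into `X`. Natural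
transformations from `F` to it correspond to subsets of `F(X)`. -/
def truthFamilies (X : B) : B ⥤ Type w where
  obj Y := (Y ⟶ X) → Prop
  map g := ↾fun φ f => φ (g ≫ f)

theorem Diagram.IsColimiting.legMap_surjective (hκ : IsColimiting κ) (X : B) :
    Function.Surjective (legMap κ (X := X)) := by
  let t : S ⟶ truthFamilies X := { app Y := ↾fun _ _ => True }
  let t' : S ⟶ truthFamilies X :=
    { app Y := ↾fun s f => ∃ e, legMap κ e = S.map f s
      naturality Y Z g := by
        ext s
        exact funext fun f => by simp [truthFamilies] }
  have ht : t = t' := by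
    refine (hκ _ (κ ≫ (const I _).map t)).unique rfl (cocone_ext fun Y e => funext fun f => ?_)
    exact eq_true ⟨restrict f e, legMap_restrict κ f e⟩
  intro s
  have hs : True = ∃ e, legMap κ e = S.map (𝟙 X) s :=
    congrArg (fun t : S ⟶ truthFamilies X => t.app X s (𝟙 X)) ht
  simpa using hs.mp trivial

theorem Diagram.IsColimiting.eqvGen_of_legMap_eq (hκ : IsColimiting κ) {X : B} {z z' : Elem D X}
    (h : legMap κ z = legMap κ z') : Relation.EqvGen Step z z' := by
  let ρ : D ⟶ (const I _).obj (truthFamilies X) :=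
    coconeOfElements (fun Y e f => Relation.EqvGen Step z (restrict f e))
      (fun Y e e' he => funext fun f => propext
        ⟨fun h => h.trans _ _ _ (.rel _ _ (he.restrict f)),
          fun h => h.trans _ _ _ (.symm _ _ (.rel _ _ (he.restrict f)))⟩)
      (fun g e => funext fun f => by rw [← restrict_comp]; rfl)
  obtain ⟨t, ht, -⟩ := hκ _ ρ
  have key (e : Elem D X) : t.app X (legMap κ e) (𝟙 X) = Relation.EqvGen Step z e :=
    (congrArg (fun f : D ⟶ (const I _).obj (truthFamilies X) => legMap f e (𝟙 X)) ht).trans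
      (congrArg _ (restrict_id e))
  rw [← key z', ← h, key z]
  exact .refl z

theorem Diagram.IsColimiting.of_isPullback (hκ : IsColimiting κ) {τ : E ⟶ D} {K : B ⥤ Type w}
    {ρ : E ⟶ (const I (B ⥤ Type w)).obj K} {k : K ⟶ S}
    (h : ∀ i, IsPullback (Hom.app τ i) (leg ρ i) (leg κ i) k) : IsColimiting ρ := by
  refine isColimiting_of_legMap (fun X c => ?_) fun X e e' he => ?_
  · obtain ⟨z, hz⟩ := hκ.legMap_surjective X (k.app X c)
    obtain ⟨x, -, hx⟩ := Types.exists_of_isPullback ((h z.1).app X) z.2 c hz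
    exact ⟨⟨z.1, x⟩, hx⟩
  · have hκe : legMap κ (elemMap τ e) = legMap κ (elemMap τ e') := by
      rw [legMap_elemMap fun i => (h i).w, he, legMap_elemMap fun i => (h i).w]
    obtain ⟨e'', hee, he''⟩ := IsCartesian.exists_eqvGen (isCartesian_of_isPullback_leg h)
      (hκ.eqvGen_of_legMap_eq hκe)
    rwa [← eq_of_elemMap_eq_of_legMap_eq h he'' ((legMap_eq_of_eqvGen ρ hee).symm.trans he)]

end Colimit

/-! ### Connected components -/

section Components

variable {I : Type u₁} [Quiver.{v₁} I] {B : Type u} [Category.{v} B] (E : Diagram I (B ⥤ Type w))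
  [∀ X, Small.{w} (Quot (Step (D := E) (X := X)))]

/-- The functor of connected components of the graphs of elements. The sum of all `E_i(X)` need not
be a `w`-small type, so that the smallness of the quotient is required. -/
noncomputable def components : B ⥤ Type w where
  obj X := Shrink.{w} (Quot (Step (D := E) (X := X)))
  map f := ↾fun c => equivShrink _ (Quot.map (restrict f) (fun _ _ => .restrict f)
    ((equivShrink (Quot Step)).symm c))
  map_id X := by
    ext c
    obtain ⟨⟨e⟩, rfl⟩ := (equivShrink _).surjective c
    simp [Quot.map, restrict_id]
  map_comp f g := by
    ext c
    obtain ⟨⟨e⟩, rfl⟩ := (equivShrink _).surjective c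
    simp [Quot.map, restrict_comp]

/-- The cocone sending an element to its connected component. -/
noncomputable def toComponents : E ⟶ (const I (B ⥤ Type w)).obj (components E) :=
  coconeOfElements (fun X e => equivShrink _ (Quot.mk Step e))
    (fun _ _ _ h => congrArg _ (Quot.sound h)) fun f e => by
      change _ = equivShrink _ (Quot.map _ _ ((equivShrink _).symm (equivShrink _ _)))
      rw [Equiv.symm_apply_apply, Quot.map]

theorem isColimiting_toComponents : IsColimiting (toComponents E) := by
  refine isColimiting_of_legMap (fun X c => ?_) fun X e e' h => ?_
  · obtain ⟨⟨e⟩, rfl⟩ := (equivShrink _).surjective c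
    exact ⟨e, rfl⟩
  · exact Quot.eqvGen_exact ((equivShrink _).injective h)

end Components

section Small

variable {I : Type u₁} [Quiver.{v₁} I] {B : Type u} [Category.{w} B]
  {D E : Diagram I (B ⥤ Type w)} {τ : E ⟶ D} {S : B ⥤ Type w}
  {κ : D ⟶ (const I (B ⥤ Type w)).obj S}

theorem Diagram.IsCartesian.small_quot_step (hτ : IsCartesian τ) (hκ : IsColimiting κ) (X : B) :
    Small.{w} (Quot (Step (D := E) (X := X))) := by
  let z := Function.surjInv (hκ.legMap_surjective X)
  let φ (p : Σ s : S.obj X, (E.obj (z s).1).obj X) : Quot (Step (D := E) (X := X)) :=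
    Quot.mk _ ⟨(z p.1).1, p.2⟩
  refine small_of_surjective (f := φ) ?_
  rintro ⟨e⟩
  obtain ⟨⟨i, x⟩, he, hx⟩ := hτ.exists_eqvGen (z := z (legMap κ (elemMap τ e)))
    (hκ.eqvGen_of_legMap_eq (Function.surjInv_eq (hκ.legMap_surjective X) _).symm)
  obtain rfl : i = _ := congrArg Sigma.fst hx
  exact ⟨⟨_, x⟩, (Quot.eqvGen_sound he).symm⟩

end Small

/-! ### Descent in the absence of simple closed paths -/

section Monodromy

variable {I : Type u₁} [Quiver.{v₁} I] {B : Type u} [Category.{v} B]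
  {D E : Diagram I (B ⥤ Type w)} {X : B} {τ : E ⟶ D}

/-- The image of a path segment under a natural transformation. -/
def PathSegment.map (τ : E ⟶ D) (s : PathSegment E X) : PathSegment D X where
  fst := elemMap τ s.fst
  edge := s.edge
  snd := elemMap τ s.snd
  valid := by
    cases s using PathSegment.forward_backward_cases with
    | forward d x => exact ⟨_, rfl, elemMap_edgeMap τ d x⟩
    | backward d x => exact ⟨_, rfl, elemMap_edgeMap τ d x⟩

theorem Connects.map {P : List (PathSegment E X)} {e e' : Elem E X} (h : Connects P e e') :
    Connects (P.map (PathSegment.map τ)) (elemMap τ e) (elemMap τ e') := by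
  induction P generalizing e with
  | nil => exact congrArg _ h
  | cons s P ih => exact ⟨congrArg (elemMap τ) h.1, ih h.2⟩

theorem Connects.exists_of_sublist {P : List (PathSegment E X)} {e e' : Elem E X}
    (h : Connects P e e') {s t : PathSegment E X} (hst : [s, t].Sublist P) :
    ∃ P₁ P₂ P₃, P = P₁ ++ s :: (P₂ ++ t :: P₃) ∧ Connects P₁ e s.fst ∧
      Connects P₂ s.snd t.fst ∧ Connects P₃ t.snd e' := by
  obtain ⟨L, R, rfl, hs, ht⟩ := List.cons_sublist_iff.1 hst
  obtain ⟨P₁, Q, rfl⟩ := List.append_of_mem hs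
  obtain ⟨Q', P₃, rfl⟩ := List.append_of_mem (List.singleton_sublist.1 ht)
  rw [List.append_assoc, List.cons_append, ← List.append_assoc] at h
  obtain ⟨_, h₁, rfl, h⟩ := connects_append.1 h
  obtain ⟨_, h₂, rfl, h₃⟩ := connects_append.1 h
  exact ⟨P₁, Q ++ Q', P₃, by simp, h₁, h₂, h₃⟩

theorem Diagram.IsCartesian.segment_ext (hτ : IsCartesian τ) {s t : PathSegment E X}
    (h : s.map τ = t.map τ) (hsnd : s.snd = t.snd) : s = t := by
  obtain ⟨hfst, hedge : s.edge = t.edge, -⟩ := PathSegment.ext_iff.1 h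
  refine PathSegment.ext ?_ hedge hsnd
  cases s using PathSegment.forward_backward_cases <;>
    cases t using PathSegment.forward_backward_cases <;> cases hedge
  · have h₁ := eq_of_heq (Sigma.mk.inj hsnd).2
    have h₂ := eq_of_heq (Sigma.mk.inj hfst).2
    rw [Types.ext_of_isPullback ((hτ _).app X) h₁ h₂]
  · cases hsnd
    rfl

/-- A shortest path that ends at another element than it starts at, but over the same element,
has a simple closed image: any coincidence of segments or elements in the image would give a
shorter such path. -/
theorem Diagram.IsCartesian.isSimpleClosed_map (hτ : IsCartesian τ) {Q : List (PathSegment E X)}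
    {e e' : Elem E X} (hQ : Connects Q e e') (he : elemMap τ e = elemMap τ e') (hne : e ≠ e')
    (hmin : ∀ (Q' : List (PathSegment E X)) (a a' : Elem E X), Q'.length < Q.length →
      Connects Q' a a' → elemMap τ a = elemMap τ a' → a = a') :
    IsSimpleClosed (Q.map (PathSegment.map τ)) (elemMap τ e) := by
  have hsnd {s t} (hst : [s, t].Sublist Q) : elemMap τ s.snd ≠ elemMap τ t.snd := fun h => by
    obtain ⟨Q₁, Q₂, Q₃, rfl, h₁, h₂, h₃⟩ := hQ.exists_of_sublist hst
    have hst' : s.snd = t.snd := hmin (Q₂ ++ [t]) _ _ (by grind)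
      (h₂.append (connects_singleton t)) h
    exact hne (hmin (Q₁ ++ s :: Q₃) _ _ (by simp) (h₁.append ⟨rfl, hst' ▸ h₃⟩) he)
  have hrev {s t} (hst : [s, t].Sublist Q) : s.map τ ≠ t.rev.map τ := fun h => by
    obtain ⟨Q₁, Q₂, Q₃, rfl, h₁, h₂, h₃⟩ := hQ.exists_of_sublist hst
    have hst' : s.snd = t.fst := hmin Q₂ _ _ (by grind) h₂ (congrArg PathSegment.snd h)
    obtain rfl : s = t.rev := hτ.segment_ext h hst'
    exact hne (hmin (Q₁ ++ Q₃) _ _ (by grind) (h₁.append h₃) he)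
  refine ⟨?_, ?_, ?_, ?_⟩
  · rintro h
    obtain rfl := List.map_eq_nil_iff.1 h
    exact hne hQ
  · simpa only [he] using hQ.map (τ := τ)
  · rw [IsProper, List.pairwise_map, List.pairwise_iff_forall_sublist]
    rintro s t hst (h | ⟨h₁, h₂, h₃⟩)
    · exact hsnd hst (congrArg PathSegment.snd h)
    · exact hrev hst (PathSegment.ext h₁ h₂ h₃)
  · rw [List.map_map, List.Nodup, List.pairwise_map, List.pairwise_iff_forall_sublist]
    exact hsnd

theorem Diagram.IsCartesian.eq_of_eqvGen (hτ : IsCartesian τ)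
    (hD : ∀ (z : Elem D X) (P : List (PathSegment D X)), ¬ IsSimpleClosed P z)
    {e e' : Elem E X} (h : Relation.EqvGen Step e e') (he : elemMap τ e = elemMap τ e') :
    e = e' := by
  obtain ⟨Q, hQ⟩ := exists_connects_of_eqvGen h
  clear h
  induction hn : Q.length using Nat.strong_induction_on generalizing Q e e' with
  | _ n ih =>
  subst hn
  by_contra hne
  exact hD _ _ (hτ.isSimpleClosed_map hQ he hne fun Q' a a' hlt hQ' ha => ih _ hlt ha Q' hQ' rfl)

end Monodromy

section Descent

variable {I : Type u₁} [Quiver.{v₁} I] {B : Type u} [Category.{w} B]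
  {D E : Diagram I (B ⥤ Type w)} {S K : B ⥤ Type w} {κ : D ⟶ (const I (B ⥤ Type w)).obj S}

theorem Diagram.IsCartesian.isPullback_leg {τ : E ⟶ D} (hτ : IsCartesian τ) (hκ : IsColimiting κ)
    {ρ : E ⟶ (const I (B ⥤ Type w)).obj K} (hρ : IsColimiting ρ) {k : K ⟶ S}
    (hk : ∀ i, Hom.app τ i ≫ leg κ i = leg ρ i ≫ k)
    (hD : ∀ (X : B) (z : Elem D X) (P : List (PathSegment D X)), ¬ IsSimpleClosed P z) (i : I) :
    IsPullback (Hom.app τ i) (leg ρ i) (leg κ i) k := by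
  refine isPullback_of_elements (hk i) (fun X x x' hx hx' => ?_) fun X y c hyc => ?_
  · exact eq_of_heq (Sigma.mk.inj (hτ.eq_of_eqvGen (hD X)
      (hρ.eqvGen_of_legMap_eq (z := ⟨i, x⟩) (z' := ⟨i, x'⟩) hx') (congrArg (Sigma.mk i) hx))).2
  · obtain ⟨e, rfl⟩ := hρ.legMap_surjective X c
    obtain ⟨⟨j, x⟩, hex, hx⟩ := hτ.exists_eqvGen (hκ.eqvGen_of_legMap_eq (z' := ⟨i, y⟩)
      ((legMap_elemMap hk e).trans hyc.symm))
    obtain rfl : j = i := congrArg Sigma.fst hx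
    exact ⟨x, eq_of_heq (Sigma.mk.inj hx).2, (legMap_eq_of_eqvGen ρ hex).symm⟩

theorem isVanKampen_of_not_isSimpleClosed (hκ : IsColimiting κ)
    (hD : ∀ (X : B) (z : Elem D X) (P : List (PathSegment D X)), ¬ IsSimpleClosed P z) :
    IsVanKampen κ := by
  have universal (σ : Over S) : IsColimiting (pullbackProj κ σ) :=
    hκ.of_isPullback (isPullback_pullbackHom σ)
  refine ⟨pullbackFunctor_faithful universal, pullbackFunctor_full universal, ⟨fun F => ?_⟩⟩
  have hF : IsCartesian F.obj.hom := F.property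
  have := hF.small_quot_step hκ
  obtain ⟨k, hk, -⟩ := isColimiting_toComponents F.obj.left S (F.obj.hom ≫ κ)
  exact (mem_essImage_pullbackFunctor_iff F).2 ⟨_, k, _, hF.isPullback_leg hκ
    (isColimiting_toComponents _) (fun i => congrArg (fun f => leg f i) hk.symm) hD⟩

end Descent

/-! ### Uniqueness of proper paths -/

section Twist

variable {I : Type u₁} [Quiver.{v₁} I] {B : Type u} [Category.{w} B]
  {D : Diagram I (B ⥤ Type w)} {X : B} (c : Quiver.Total I × Elem D X → ZMod 2)

/-- The double covering of the graph of elements of sort `X` given by a `ZMod 2`-valued function `c`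
on its edges, as a diagram over `D`. To act at the sort `X` alone, it is coinduced to all sorts: a
point of the fibre at sort `Y` is a choice of a sheet at every `f : Y ⟶ X`. -/
def twist : Diagram I (B ⥤ Type w) where
  obj i :=
    { obj Y := (D.obj i).obj Y × ((Y ⟶ X) → ZMod 2)
      map g := ↾fun p => ((D.obj i).map g p.1, fun f => p.2 (g ≫ f)) }
  map {i j} d :=
    { app Y := ↾fun p => ((D.map d).app Y p.1,
        fun f => p.2 f + c (⟨i, j, d⟩, restrict f ⟨i, p.1⟩))
      naturality Y Z g := by ext p <;> simp [restrict] }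

/-- The projection of the double covering. -/
def twistHom : twist c ⟶ D where
  app i := { app Y := ↾fun p => p.1 }
  naturality d := rfl

theorem isCartesian_twistHom : IsCartesian (twistHom c) := by
  intro i j d
  refine isPullback_of_elements ((twistHom c).naturality d) ?_ ?_
  · rintro Y ⟨y, φ⟩ ⟨y', φ'⟩ h hy
    obtain rfl : y = y' := hy
    exact Prod.ext rfl (funext fun f => add_right_cancel (congrFun (Prod.ext_iff.1 h).2 f))
  · rintro Y ⟨y', φ⟩ y rfl
    refine ⟨(y, fun f => φ f - c (⟨i, j, d⟩, restrict f ⟨i, y⟩)), Prod.ext rfl ?_, rfl⟩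
    exact funext fun f => sub_add_cancel _ _

/-- The point of the double covering over the element `z` given by a choice `φ` of sheets. -/
def twistElem (z : Elem D X) (φ : (X ⟶ X) → ZMod 2) : Elem (twist c) X := ⟨z.1, z.2, φ⟩

theorem step_twistElem {i j : I} (d : i ⟶ j) (y : (D.obj i).obj X) (φ : (X ⟶ X) → ZMod 2) :
    Step (twistElem c ⟨i, y⟩ φ) (twistElem c ⟨j, edgeMap D X d y⟩
      fun f => φ f + c (⟨i, j, d⟩, restrict f ⟨i, y⟩)) :=
  Step.intro (D := twist c) (X := X) d (y, φ)

theorem exists_eqvGen_twistElem {P : List (PathSegment D X)} {z z' : Elem D X}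
    (h : Connects P z z') (φ : (X ⟶ X) → ZMod 2) :
    ∃ φ', Relation.EqvGen Step (twistElem c z φ) (twistElem c z' φ') ∧
      φ' (𝟙 X) = φ (𝟙 X) + (P.map fun s => c s.key).sum := by
  induction P generalizing z φ with
  | nil =>
    obtain rfl : z = z' := h
    exact ⟨φ, .refl _, by simp⟩
  | cons s P ih =>
    obtain ⟨rfl, h⟩ := h
    cases s using PathSegment.forward_backward_cases with
    | @forward i j d y =>
      obtain ⟨φ', hφ, hφ'⟩ := ih h (fun f => φ f + c (⟨i, j, d⟩, restrict f ⟨i, y⟩))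
      refine ⟨φ', .trans _ _ _ (.rel _ _ (step_twistElem c d y φ)) hφ, ?_⟩
      rw [hφ', restrict_id, List.map_cons, List.sum_cons, add_assoc]
      rfl
    | @backward i j d y =>
      let ψ : (X ⟶ X) → ZMod 2 := fun f => φ f - c (⟨i, j, d⟩, restrict f ⟨i, y⟩)
      have hψ : (fun f => ψ f + c (⟨i, j, d⟩, restrict f ⟨i, y⟩)) = φ :=
        funext fun f => sub_add_cancel _ _
      have hstep := step_twistElem c d y ψ
      rw [hψ] at hstep
      obtain ⟨φ', hφ, hφ'⟩ := ih h ψ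
      refine ⟨φ', .trans _ _ _ (.symm _ _ (.rel _ _ hstep)) hφ, ?_⟩
      rw [hφ', List.map_cons, List.sum_cons]
      simp only [ψ, restrict_id, CharTwo.sub_eq_add, add_assoc]
      rfl

end Twist

section Uniqueness

variable {I : Type u₁} [Quiver.{v₁} I] {B : Type u} [Category.{w} B]
  {D : Diagram I (B ⥤ Type w)} {X : B} {S : B ⥤ Type w}
  {κ : D ⟶ (const I (B ⥤ Type w)).obj S} {P P' : List (PathSegment D X)} {z z' : Elem D X}

theorem Diagram.IsVanKampen.sum_eq (hκ : IsVanKampen κ) (hP : Connects P z z')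
    (hP' : Connects P' z z') (c : Quiver.Total I × Elem D X → ZMod 2) :
    (P.map fun s => c s.key).sum = (P'.map fun s => c s.key).sum := by
  have : (pullbackFunctor κ).IsEquivalence := hκ
  obtain ⟨K, k, ρ, h⟩ := (mem_essImage_pullbackFunctor_iff (κ := κ)
    ⟨Over.mk (twistHom c), isCartesian_twistHom c⟩).1 (Functor.EssSurj.mem_essImage _ _)
  obtain ⟨φ, hφ, hφP⟩ := exists_eqvGen_twistElem c hP 0
  obtain ⟨φ', hφ', hφP'⟩ := exists_eqvGen_twistElem c hP' 0
  have hρ : legMap ρ (twistElem c z' φ) = legMap ρ (twistElem c z' φ') :=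
    legMap_eq_of_eqvGen ρ (.trans _ _ _ (.symm _ _ hφ) hφ')
  have heq : twistElem c z' φ = twistElem c z' φ' := eq_of_elemMap_eq_of_legMap_eq h rfl hρ
  obtain rfl : φ = φ' := (Prod.ext_iff.1 (eq_of_heq (Sigma.mk.inj heq).2)).2
  exact add_left_cancel (hφP.symm.trans hφP')

open Classical in
theorem IsProper.sum_ite_key_eq (hP : IsProper P) (k : Quiver.Total I × Elem D X) :
    (P.map fun s => if s.key = k then (1 : ZMod 2) else 0).sum =
      if k ∈ P.map PathSegment.key then 1 else 0 := by
  have hsum := List.sum_toFinset (fun a => if a = k then (1 : ZMod 2) else 0)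
    (isProper_iff_nodup.1 hP)
  rw [List.map_map] at hsum
  refine hsum.symm.trans ?_
  simp only [Finset.sum_ite_eq', List.mem_toFinset]

theorem Diagram.IsVanKampen.mem_map_key_iff (hκ : IsVanKampen κ) (hP : Connects P z z')
    (hp : IsProper P) (hP' : Connects P' z z') (hp' : IsProper P')
    (k : Quiver.Total I × Elem D X) :
    k ∈ P.map PathSegment.key ↔ k ∈ P'.map PathSegment.key := by
  classical
  have hsum := hκ.sum_eq hP hP' fun a => if a = k then 1 else 0
  rw [hp.sum_ite_key_eq, hp'.sum_ite_key_eq] at hsum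
  by_cases h : k ∈ P.map PathSegment.key <;> by_cases h' : k ∈ P'.map PathSegment.key <;>
    simp only [h, h', if_true, if_false, one_ne_zero, zero_ne_one] at hsum ⊢

theorem Diagram.IsVanKampen.eq_nil (hκ : IsVanKampen κ) (hP : Connects P z z)
    (hp : IsProper P) : P = [] :=
  List.eq_nil_iff_forall_not_mem.2 fun _ hs =>
    List.not_mem_nil ((hκ.mem_map_key_iff hP hp (P' := []) rfl .nil _).1 (List.mem_map_of_mem hs))

theorem Diagram.IsVanKampen.path_unique (hκ : IsVanKampen κ) (hP : Connects P z z')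
    (hp : IsProper P) (hP' : Connects P' z z') (hp' : IsProper P') : P = P' := by
  induction P generalizing z P' with
  | nil =>
    obtain rfl : z = z' := hP
    exact (hκ.eq_nil hP' hp').symm
  | cons s P ih =>
    obtain ⟨t, ht, hts⟩ := List.mem_map.1
      ((hκ.mem_map_key_iff hP hp hP' hp' s.key).1 List.mem_cons_self)
    obtain ⟨L, R, rfl⟩ := List.append_of_mem ht
    obtain ⟨_, hL, rfl, hR⟩ := connects_append.1 hP'
    rw [IsProper, List.append_cons, List.pairwise_append] at hp'
    obtain ⟨hpL, hpR, -⟩ := hp'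
    rcases weaklyEqual_iff_key_eq.2 hts with rfl | ⟨-, -, h⟩
    · obtain rfl : L = [] := hκ.eq_nil (hP.1 ▸ hL) (List.pairwise_append.1 hpL).1
      rw [ih hP.2 (List.pairwise_cons.1 hp).2 hR hpR]
      rfl
    · have hLt : Connects (L ++ [t]) z z := hL.append ⟨rfl, h.trans hP.1⟩
      simpa using hκ.eq_nil hLt hpL

end Uniqueness

end GraphVK

theorem theorem6p12_general {B : Type u} [Category.{w} B] {I : Type u₁} [Quiver.{v₁} I]
    (hI : WellFounded fun i j : I => Nonempty (j ⟶ i))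
    (D : GraphVK.Diagram I (B ⥤ Type w)) (hD : GraphVK.ImageDisjoint D)
    (S : B ⥤ Type w) (κ : D ⟶ (GraphVK.Diagram.const I (B ⥤ Type w)).obj S)
    (hκ : GraphVK.Diagram.IsColimiting κ) :
    List.TFAE [
      GraphVK.Diagram.IsVanKampen κ,
      ∀ (X : B) (i j : I), GraphVK.IsAffected i → GraphVK.IsAffected j →
        ∀ (z : (D.obj i).obj X) (z' : (D.obj j).obj X),
          ¬ ∃ P P' : List (GraphVK.PathSegment D X), P ≠ P' ∧
            GraphVK.Connects P ⟨i, z⟩ ⟨j, z'⟩ ∧ GraphVK.IsProper P ∧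
            GraphVK.Connects P' ⟨i, z⟩ ⟨j, z'⟩ ∧ GraphVK.IsProper P',
      ∀ (X : B) (i j : I), GraphVK.IsAffected i → GraphVK.IsAffected j →
        ∀ (z : (D.obj i).obj X) (z' : (D.obj j).obj X),
          ¬ ∃ P P' : List (GraphVK.PathSegment D X), P ≠ P' ∧
            GraphVK.Connects P ⟨i, z⟩ ⟨j, z'⟩ ∧ GraphVK.IsProper P ∧
            GraphVK.IsInnerCycleFree P ∧
            GraphVK.Connects P' ⟨i, z⟩ ⟨j, z'⟩ ∧ GraphVK.IsProper P' ∧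
            GraphVK.IsInnerCycleFree P'] := by
  tfae_have 1 → 2 := by
    rintro h X i j - - z z' ⟨P, P', hne, hP, hp, hP', hp'⟩
    exact hne (h.path_unique hP hp hP' hp')
  tfae_have 2 → 3 := by
    rintro h X i j hi hj z z' ⟨P, P', hne, hP, hp, -, hP', hp', -⟩
    exact h X i j hi hj z z' ⟨P, P', hne, hP, hp, hP', hp'⟩
  tfae_have 3 → 1 := by
    intro h
    refine GraphVK.isVanKampen_of_not_isSimpleClosed hκ fun X z P hP => ?_
    obtain ⟨m, m', Q, Q', hm, hm', hne, hQ, hQ'⟩ := hP.exists_ne_isSimplePath hI hD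
    exact h X m.1 m'.1 hm hm' m.2 m'.2 ⟨Q, Q', hne, hQ.connects, hQ.isProper,
      hQ.isInnerCycleFree, hQ'.connects, hQ'.isProper, hQ'.isInnerCycleFree⟩
  tfae_finish

theorem theorem6p12 {B : Type u} [SmallCategory B]
    {I : Type u₁} [Quiver.{v₁} I] [Finite I] [Finite (Quiver.Total I)]
    (hI : GraphVK.NoDirectedCycles I)
    (D : GraphVK.Diagram I (B ⥤ Type u)) (hD : GraphVK.ImageDisjoint D)
    (S : B ⥤ Type u) (κ : D ⟶ (GraphVK.Diagram.const I (B ⥤ Type u)).obj S)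
    (hκ : GraphVK.Diagram.IsColimiting κ) :
    List.TFAE [
      GraphVK.Diagram.IsVanKampen κ,
      ∀ (X : B) (i j : I), GraphVK.IsAffected i → GraphVK.IsAffected j →
        ∀ (z : (D.obj i).obj X) (z' : (D.obj j).obj X),
          ¬ ∃ P P' : List (GraphVK.PathSegment D X), P ≠ P' ∧
            GraphVK.Connects P ⟨i, z⟩ ⟨j, z'⟩ ∧ GraphVK.IsProper P ∧
            GraphVK.Connects P' ⟨i, z⟩ ⟨j, z'⟩ ∧ GraphVK.IsProper P',
      ∀ (X : B) (i j : I), GraphVK.IsAffected i → GraphVK.IsAffected j →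
        ∀ (z : (D.obj i).obj X) (z' : (D.obj j).obj X),
          ¬ ∃ P P' : List (GraphVK.PathSegment D X), P ≠ P' ∧
            GraphVK.Connects P ⟨i, z⟩ ⟨j, z'⟩ ∧ GraphVK.IsProper P ∧
            GraphVK.IsInnerCycleFree P ∧
            GraphVK.Connects P' ⟨i, z⟩ ⟨j, z'⟩ ∧ GraphVK.IsProper P' ∧
            GraphVK.IsInnerCycleFree P'] :=
  theorem6p12_general hI.wellFounded D hD S κ hκ
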